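/- Let $(\Omega,\mathcal F,\mu)$ be a probability space (not necessarily complete) and let $(\mathcal F_n)_{n\ge 0}$ be an increasing sequence of sub-$\sigma$-fields of $\mathcal F$ with $\mathcal F=\bigvee_{n\ge0}\mathcal F_n$. A weight is a random variable $\omega$ with $\omega>0$ a.s. and $\mathbb E(\omega)<\infty$. Write $\omega_n=\mathbb E(\omega|\mathcal F_n)$, and let $\mathbb E_\omega(\cdot|\mathcal F_n)$ be the conditional expectation with respect to the measure $\omega\,d\mu$. Conditional expectations of non-negative functions take values in $[0,\infty]$, and $\mathbb E(\log\omega|\mathcal F_n)=\mathbb E(\log^+\omega|\mathcal F_n)-\mathbb E(\log^-\omega|\mathcal F_n)\in[-\infty,\infty)$, with $\exp(-\infty)=0$. All inequalities and implications between random variables below hold at $\mu$-almost every point. The weight $\omega$ satisfies the regularity condition $S$ if there is $C>1$ with $\frac1C\,\omega_{n-1}\le\omega_n\le C\,\omega_{n-1}$ for all $n\ge1$. **Theorem.** Let $\omega$ be a weight. If $\omega\in S$, then the following are equivalent. 1. ($\omega\in\bigcup_{p>1}A_p$) There exist $C,p>1$ such that for all $n\ge0$: $\mathbb E(\omega|\mathcal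 F_n)\,\mathbb E(\omega^{-\frac1{p-1}}|\mathcal F_n)^{p-1}\le C$. 2. ($\omega\in A^{exp}_\infty$) There exists $C>0$ such that for all $n\ge0$: $\mathbb E(\omega|\mathcal F_n)\le C\exp\mathbb E(\log\omega|\mathcal F_n)$. 3. ($\omega\in A^{con}_\infty$) There exist $0<\gamma,\delta<1$ such that for all $n\ge0$: $\mathbb E(\chi_{\{\omega\le\gamma\omega_n\}}|\mathcal F_n)\le\delta$. 4. ($\omega\in A^{M}_\infty$) There exist $0<\alpha,\beta<1$ such that for all $n\ge0$ and $A\in\mathcal F$: $\mathbb E(\chi_A|\mathcal F_n)\le\alpha\Rightarrow\mathbb E_\omega(\chi_A|\mathcal F_n)\le\beta$. 5. ($\omega\in\bigcup_{q>1}RH_q$) There exist $C,q>1$ such that for all $n\ge0$: $\mathbb E(\omega^q|\mathcal F_n)\le C\,\mathbb E(\omega|\mathcal F_n)^q$. 6. ($\omega\in A^{CF}_\infty$) There exist $0<\varepsilon'<1$ and $C>1$ such that for all $n\ge0$ and $A\in\mathcal F$: $\mathbb E_\omega(\chi_A|\mathcal F_n)\le C\,\mathbb E(\chi_A|\mathcal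 F_n)^{\varepsilon'}$. 7. ($\omega\in\hat A^{M}_\infty$) There exist $0<\alpha,\beta<1$ such that for all $n\ge0$ and $A\in\mathcal F$: $\mathbb E_\omega(\chi_A|\mathcal F_n)\le\alpha\Rightarrow\mathbb E(\chi_A|\mathcal F_n)\le\beta$. Moreover, the implications $1\Rightarrow2\Rightarrow3\Rightarrow4$ and $5\Rightarrow6\Rightarrow7$ hold for every weight $\omega$, without assuming $\omega\in S$. -/

import Mathlib

open MeasureTheory
open scoped ENNReal

namespace MartingaleWeight

noncomputable section

/-- A weight: an (almost surely) strictly positive random variable with finite expectation. -/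
structure IsWeight {Ω : Type*} {m0 : MeasurableSpace Ω} (μ : Measure Ω) (ω : Ω → ℝ) : Prop where
  measurable : Measurable ω
  pos : ∀ᵐ x ∂μ, 0 < ω x
  integrable : Integrable ω μ

/-- `ω_n = E(ω | F_n)`. All conditional expectations of non-negative functions are taken with
values in `[0, ∞]`, so that they are meaningful without any integrability. -/
def wexp {Ω : Type*} {m0 : MeasurableSpace Ω} (μ : Measure Ω) (ℱ : Filtration ℕ m0)
    (ω : Ω → ℝ) (n : ℕ) : Ω → ℝ≥0∞ :=
  μ⁻[fun x => ENNReal.ofReal (ω x) | ℱ n]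

/-- `E(ω ^ r | F_n)`, for a real exponent `r` (of either sign). -/
def powExp {Ω : Type*} {m0 : MeasurableSpace Ω} (μ : Measure Ω) (ℱ : Filtration ℕ m0)
    (ω : Ω → ℝ) (r : ℝ) (n : ℕ) : Ω → ℝ≥0∞ :=
  μ⁻[fun x => ENNReal.ofReal (ω x ^ r) | ℱ n]

/-- `E(χ_A | F_n)` with respect to the measure `μ`. -/
def condProb {Ω : Type*} {m0 : MeasurableSpace Ω} (μ : Measure Ω) (ℱ : Filtration ℕ m0)
    (A : Set Ω) (n : ℕ) : Ω → ℝ≥0∞ :=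
  μ⁻[A.indicator (fun _ => 1) | ℱ n]

/-- The measure `ω dμ`. Conditional expectation with respect to it is `E_ω`. -/
def weighted {Ω : Type*} {m0 : MeasurableSpace Ω} (μ : Measure Ω) (ω : Ω → ℝ) : Measure Ω :=
  μ.withDensity (fun x => ENNReal.ofReal (ω x))

/-- `E(log ω | F_n)` with values in `[-∞, ∞]`: the conditional expectation of the positive part of
`log ω` minus that of its negative part. For a weight the first one is almost surely finite,
because `log⁺ ω ≤ ω`. -/
def logExp {Ω : Type*} {m0 : MeasurableSpace Ω} (μ : Measure Ω) (ℱ : Filtration ℕ m0)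
    (ω : Ω → ℝ) (n : ℕ) (x : Ω) : EReal :=
  ((μ⁻[fun y => ENNReal.ofReal (Real.log (ω y)) | ℱ n] x : ℝ≥0∞) : EReal)
    - ((μ⁻[fun y => ENNReal.ofReal (-Real.log (ω y)) | ℱ n] x : ℝ≥0∞) : EReal)

/-- The regularity condition `S`: `ω_{n-1} / C ≤ ω_n ≤ C ω_{n-1}` for all `n ≥ 1`. -/
def CondS {Ω : Type*} {m0 : MeasurableSpace Ω} (μ : Measure Ω) (ℱ : Filtration ℕ m0)
    (ω : Ω → ℝ) : Prop :=
  ∃ C : ℝ, 1 < C ∧ ∀ n : ℕ, ∀ᵐ x ∂μ,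
    ENNReal.ofReal (1 / C) * wexp μ ℱ ω n x ≤ wexp μ ℱ ω (n + 1) x ∧
      wexp μ ℱ ω (n + 1) x ≤ ENNReal.ofReal C * wexp μ ℱ ω n x

/-- `⋃_{p > 1} A_p`. -/
def UnionAp {Ω : Type*} {m0 : MeasurableSpace Ω} (μ : Measure Ω) (ℱ : Filtration ℕ m0)
    (ω : Ω → ℝ) : Prop :=
  ∃ C p : ℝ, 1 < C ∧ 1 < p ∧ ∀ n : ℕ, ∀ᵐ x ∂μ,
    wexp μ ℱ ω n x * powExp μ ℱ ω (-(1 / (p - 1))) n x ^ (p - 1) ≤ ENNReal.ofReal C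

/-- `A_∞^exp`. -/
def AExp {Ω : Type*} {m0 : MeasurableSpace Ω} (μ : Measure Ω) (ℱ : Filtration ℕ m0)
    (ω : Ω → ℝ) : Prop :=
  ∃ C : ℝ, 0 < C ∧ ∀ n : ℕ, ∀ᵐ x ∂μ,
    wexp μ ℱ ω n x ≤ ENNReal.ofReal C * EReal.exp (logExp μ ℱ ω n x)

/-- `A_∞^con`. -/
def ACon {Ω : Type*} {m0 : MeasurableSpace Ω} (μ : Measure Ω) (ℱ : Filtration ℕ m0)
    (ω : Ω → ℝ) : Prop :=
  ∃ γ δ : ℝ, 0 < γ ∧ γ < 1 ∧ 0 < δ ∧ δ < 1 ∧ ∀ n : ℕ, ∀ᵐ x ∂μ,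
    condProb μ ℱ {y | ENNReal.ofReal (ω y) ≤ ENNReal.ofReal γ * wexp μ ℱ ω n y} n x
      ≤ ENNReal.ofReal δ

/-- `A_∞^M`. The implication holds at almost every point. -/
def AM {Ω : Type*} {m0 : MeasurableSpace Ω} (μ : Measure Ω) (ℱ : Filtration ℕ m0)
    (ω : Ω → ℝ) : Prop :=
  ∃ α β : ℝ, 0 < α ∧ α < 1 ∧ 0 < β ∧ β < 1 ∧
    ∀ n : ℕ, ∀ A : Set Ω, MeasurableSet A → ∀ᵐ x ∂μ,
      condProb μ ℱ A n x ≤ ENNReal.ofReal α →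
        condProb (weighted μ ω) ℱ A n x ≤ ENNReal.ofReal β

/-- `⋃_{q > 1} RH_q`, the reverse Hölder condition. -/
def UnionRH {Ω : Type*} {m0 : MeasurableSpace Ω} (μ : Measure Ω) (ℱ : Filtration ℕ m0)
    (ω : Ω → ℝ) : Prop :=
  ∃ C q : ℝ, 1 < C ∧ 1 < q ∧ ∀ n : ℕ, ∀ᵐ x ∂μ,
    powExp μ ℱ ω q n x ≤ ENNReal.ofReal C * wexp μ ℱ ω n x ^ q

/-- `A_∞^CF`. -/
def ACF {Ω : Type*} {m0 : MeasurableSpace Ω} (μ : Measure Ω) (ℱ : Filtration ℕ m0)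
    (ω : Ω → ℝ) : Prop :=
  ∃ ε C : ℝ, 0 < ε ∧ ε < 1 ∧ 1 < C ∧
    ∀ n : ℕ, ∀ A : Set Ω, MeasurableSet A → ∀ᵐ x ∂μ,
      condProb (weighted μ ω) ℱ A n x ≤ ENNReal.ofReal C * condProb μ ℱ A n x ^ ε

/-- The reverse condition, `A_∞^M` with a hat. The implication holds at almost every point. -/
def AMHat {Ω : Type*} {m0 : MeasurableSpace Ω} (μ : Measure Ω) (ℱ : Filtration ℕ m0)
    (ω : Ω → ℝ) : Prop :=
  ∃ α β : ℝ, 0 < α ∧ α < 1 ∧ 0 < β ∧ β < 1 ∧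
    ∀ n : ℕ, ∀ A : Set Ω, MeasurableSet A → ∀ᵐ x ∂μ,
      condProb (weighted μ ω) ℱ A n x ≤ ENNReal.ofReal α →
        condProb μ ℱ A n x ≤ ENNReal.ofReal β

end

end MartingaleWeight

/-! The seven conditions are linked in one cycle. Five links are pointwise inequalities to which
conditional expectation is applied: Jensen for 1 ⇒ 2, a Chebyshev estimate of `log (ω / ω_n)` for 2
⇒ 3, splitting according to whether ω is small against `ω_n` for 3 ⇒ 4, truncation for 5 ⇒ 6, and
complements for 6 ⇒ 7. None of these needs S.

The substance is 4 ⇒ 5, a Calderón–Zygmund argument in `exists_reverseHolder`. Stop when the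
martingale `ω_i` first exceeds `b ^ k * ω_n`. By the upper half of S it overshoots by a factor at
most C, so Doob's maximal inequality bounds by `C / b ≤ α` the conditional probability of ever
exceeding `b ^ (k + 1) * ω_n`. Condition 4 turns this into a bound β for the weighted probability,
and iteration gives `β ^ k` at level k. As `ω_i → ω`, these events control ω, and a geometric series
with `b ^ r * β < 1` bounds `E_ω(ω ^ r | F_n)`; by Bayes this is the reverse Hölder inequality with
exponent `1 + r`.

The link 7 ⇒ 1 is the same theorem for the dual pair: base measure `ω dμ` and weight `1 / ω`. Its
density martingale is `1 / ω_n`, so the lower half of S takes the place of the upper half, and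
reverse Hölder for `1 / ω` is an `A_p` condition. -/

namespace MartingaleWeight

/-! ### Conditional expectations with values in [0, ∞] -/

section CondLExp

variable {Ω : Type*} {m m0 : MeasurableSpace Ω} {μ : Measure Ω}

/-- The measures with densities `μ⁻[f | m]` and `f` agree on `m`, hence give the same integral to
every `m`-measurable function; no integrability is needed. -/
theorem setLIntegral_mul_condLExp (hm : m ≤ m0) [SigmaFinite (μ.trim hm)] {f g : Ω → ℝ≥0∞}
    (hf : Measurable f) (hg : Measurable[m] g) {s : Set Ω} (hs : MeasurableSet[m] s) :
    ∫⁻ x in s, g x * μ⁻[f | m] x ∂μ = ∫⁻ x in s, g x * f x ∂μ := by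
  have key : (μ.withDensity μ⁻[f | m]).trim hm = (μ.withDensity f).trim hm := by
    refine @Measure.ext _ m _ _ fun t ht => ?_
    rw [trim_measurableSet_eq hm ht, trim_measurableSet_eq hm ht, withDensity_apply _ (hm _ ht),
      withDensity_apply _ (hm _ ht), setLIntegral_condLExp hm μ f ht]
  have h1 : ∀ u : Ω → ℝ≥0∞, Measurable u →
      ∫⁻ x in s, g x * u x ∂μ = ∫⁻ x, s.indicator g x ∂((μ.withDensity u).trim hm) := by
    intro u hu
    rw [lintegral_trim hm (hg.indicator hs), lintegral_indicator (hm _ hs),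
      setLIntegral_withDensity_eq_setLIntegral_mul _ hu (hg.mono hm le_rfl) (hm _ hs)]
    simp only [Pi.mul_apply, mul_comm]
  rw [h1 _ (by fun_prop), h1 _ hf, key]

/-- The pull-out property of the conditional Lebesgue expectation. -/
theorem condLExp_mul_left (hm : m ≤ m0) [SigmaFinite (μ.trim hm)] {f g : Ω → ℝ≥0∞}
    (hf : Measurable f) (hg : Measurable[m] g) :
    μ⁻[fun x => g x * f x | m] =ᵐ[μ] fun x => g x * μ⁻[f | m] x :=
  (ae_eq_condLExp hm μ _ (hg.mul (measurable_condLExp m μ f))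
    fun _ hs => setLIntegral_mul_condLExp hm hf hg hs).symm

theorem condLExp_le_of_forall_setLIntegral_le (hm : m ≤ m0) [SigmaFinite (μ.trim hm)]
    {f g : Ω → ℝ≥0∞} (hg : Measurable[m] g)
    (h : ∀ s, MeasurableSet[m] s → ∫⁻ x in s, f x ∂μ ≤ ∫⁻ x in s, g x ∂μ) :
    μ⁻[f | m] ≤ᵐ[μ] g := by
  apply ae_le_of_ae_le_trim (hm := hm)
  apply ae_le_of_forall_setLIntegral_le_of_sigmaFinite (by fun_prop)
  intro s hs _
  rw [setLIntegral_condLExp_trim hm _ _ hs, setLIntegral_trim hm hg hs]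
  exact h s hs

theorem condLExp_fun_add {f : Ω → ℝ≥0∞} (hf : Measurable f) (g : Ω → ℝ≥0∞) :
    μ⁻[fun x => f x + g x | m] =ᵐ[μ] fun x => μ⁻[f | m] x + μ⁻[g | m] x :=
  condLExp_add_left g hf.aemeasurable

theorem condLExp_fun_const_mul {f : Ω → ℝ≥0∞} (hf : Measurable f) (c : ℝ≥0∞) :
    μ⁻[fun x => c * f x | m] =ᵐ[μ] fun x => c * μ⁻[f | m] x :=
  condLExp_smul f hf.aemeasurable c

/-- The zero set of the conditional expectation lies in `m`, so `f` integrates to zero over it and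
vanishes there almost everywhere. -/
theorem condLExp_pos (hm : m ≤ m0) [SigmaFinite (μ.trim hm)] {f : Ω → ℝ≥0∞}
    (hf : Measurable f) (hpos : ∀ᵐ x ∂μ, f x ≠ 0) : ∀ᵐ x ∂μ, μ⁻[f | m] x ≠ 0 := by
  have hs : MeasurableSet[m] {x | μ⁻[f | m] x = 0} :=
    measurable_condLExp m μ f (measurableSet_singleton 0)
  have h := setLIntegral_condLExp hm μ f hs
  rw [setLIntegral_congr_fun (hm _ hs) (fun x hx => hx), lintegral_zero, eq_comm,
    lintegral_eq_zero_iff hf] at h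
  have h' := (ae_restrict_iff' (hm _ hs)).1 h
  filter_upwards [h', hpos] with x hx hx0 h0
  exact hx0 (hx h0)

theorem condLExp_indicator_le_one (hm : m ≤ m0) [SigmaFinite (μ.trim hm)] (A : Set Ω) :
    ∀ᵐ x ∂μ, μ⁻[A.indicator (fun _ => 1) | m] x ≤ 1 := by
  have h : μ⁻[A.indicator (fun _ => 1) | m] ≤ᵐ[μ] μ⁻[fun _ => 1 | m] :=
    condLExp_mono (.of_forall fun x => Set.indicator_le_self' (by simp) x)
  rwa [condLExp_const hm] at h

theorem condLExp_indicator_add_compl (hm : m ≤ m0) [SigmaFinite (μ.trim hm)] {A : Set Ω}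
    (hA : MeasurableSet A) : ∀ᵐ x ∂μ,
      μ⁻[A.indicator (fun _ => 1) | m] x + μ⁻[Aᶜ.indicator (fun _ => 1) | m] x = 1 := by
  have h := condLExp_add_left (P := μ) (mΩ := m) (Aᶜ.indicator (fun _ => (1 : ℝ≥0∞)))
    (measurable_const.indicator hA : Measurable (A.indicator (fun _ => (1 : ℝ≥0∞)))).aemeasurable
  rw [Set.indicator_self_add_compl, condLExp_const hm] at h
  filter_upwards [h] with x hx using hx.symm

/-- Bayes' formula for the change of measure with density `W`. -/
theorem condLExp_withDensity (hm : m ≤ m0) [IsFiniteMeasure μ] {W f : Ω → ℝ≥0∞}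
    (hW : Measurable W) (hint : ∫⁻ x, W x ∂μ ≠ ∞) (hf : Measurable f) :
    μ⁻[fun x => W x * f x | m] =ᵐ[μ]
      fun x => μ⁻[W | m] x * (μ.withDensity W)⁻[f | m] x := by
  have := isFiniteMeasure_withDensity hint
  have hg := measurable_condLExp m (μ.withDensity W) f
  refine (ae_eq_condLExp hm μ _ ((measurable_condLExp m μ W).mul hg) fun s hs => ?_).symm
  simp only [Pi.mul_apply, mul_comm (μ⁻[W | m] _)]
  rw [setLIntegral_mul_condLExp hm hW hg hs]
  have h := setLIntegral_condLExp hm (μ.withDensity W) f hs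
  rw [setLIntegral_withDensity_eq_setLIntegral_mul _ hW (hg.mono hm le_rfl) (hm _ hs),
    setLIntegral_withDensity_eq_setLIntegral_mul _ hW hf (hm _ hs)] at h
  simpa only [Pi.mul_apply, mul_comm] using h

end CondLExp

/-! ### First passage times and the conditional maximal inequality -/

section FirstPassage

variable {Ω : Type*} {m0 : MeasurableSpace Ω} {μ : Measure Ω} {ℱ : Filtration ℕ m0}
  {w : ℕ → Ω → ℝ≥0∞} {c : Ω → ℝ≥0∞} {n : ℕ}

/-- The event that the sequence `w` exceeds the level `c` at some time `i ≥ n`. -/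
def passage (w : ℕ → Ω → ℝ≥0∞) (c : Ω → ℝ≥0∞) (n : ℕ) : Set Ω :=
  {x | ∃ i, n ≤ i ∧ c x < w i x}

/-- The event that `i` is the first time at or after `n` at which `w` exceeds the level `c`. -/
def firstPassage (w : ℕ → Ω → ℝ≥0∞) (c : Ω → ℝ≥0∞) (n i : ℕ) : Set Ω :=
  {x | n ≤ i ∧ c x < w i x ∧ ∀ l, n ≤ l → l < i → w l x ≤ c x}

theorem iUnion_firstPassage (w : ℕ → Ω → ℝ≥0∞) (c : Ω → ℝ≥0∞) (n : ℕ) :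
    ⋃ i, firstPassage w c n i = passage w c n := by
  classical
  ext x
  simp only [Set.mem_iUnion]
  constructor
  · rintro ⟨i, hi, hc, -⟩
    exact ⟨i, hi, hc⟩
  · intro h
    refine ⟨Nat.find h, (Nat.find_spec h).1, (Nat.find_spec h).2, fun l hl hlt => ?_⟩
    by_contra hcon
    exact Nat.find_min h hlt ⟨hl, not_le.1 hcon⟩

theorem pairwise_disjoint_firstPassage (w : ℕ → Ω → ℝ≥0∞) (c : Ω → ℝ≥0∞) (n : ℕ) :
    Pairwise (Function.onFun Disjoint (firstPassage w c n)) := by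
  intro i j hij
  refine Set.disjoint_left.2 ?_
  rintro x ⟨hi, hci, hli⟩ ⟨hj, hcj, hlj⟩
  rcases lt_or_gt_of_ne hij with h | h
  · exact (hlj i hi h).not_gt hci
  · exact (hli j hj h).not_gt hcj

theorem measurableSet_firstPassage (hw : ∀ i, Measurable[ℱ i] (w i)) (hc : Measurable[ℱ n] c)
    (i : ℕ) : MeasurableSet[ℱ i] (firstPassage w c n i) := by
  by_cases hi : n ≤ i
  · have hc' : Measurable[ℱ i] c := hc.mono (ℱ.mono hi) le_rfl
    have : firstPassage w c n i =
        {x | c x < w i x} ∩ ⋂ l, ⋂ (_ : n ≤ l), ⋂ (_ : l < i), {x | w l x ≤ c x} := by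
      ext x
      simp [firstPassage, hi]
    rw [this]
    refine (measurableSet_lt hc' (hw i)).inter ?_
    refine MeasurableSet.iInter fun l => MeasurableSet.iInter fun _ =>
      MeasurableSet.iInter fun hl => ?_
    exact measurableSet_le ((hw l).mono (ℱ.mono hl.le) le_rfl) hc'
  · have : firstPassage w c n i = ∅ := by
      ext x
      simp [firstPassage, hi]
    rw [this]
    exact @MeasurableSet.empty _ (ℱ i)

theorem measurableSet_passage (hw : ∀ i, Measurable[ℱ i] (w i)) (hc : Measurable[ℱ n] c) :
    MeasurableSet (passage w c n) := by
  rw [← iUnion_firstPassage]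
  exact MeasurableSet.iUnion fun i => ℱ.le i _ (measurableSet_firstPassage hw hc i)

/-- The conditional form of Doob's weak type maximal inequality. -/
theorem mul_condLExp_passage_le [IsFiniteMeasure μ] {W : Ω → ℝ≥0∞}
    (hc : Measurable[ℱ n] c) :
    ∀ᵐ x ∂μ, c x * μ⁻[(passage (fun i => μ⁻[W | ℱ i]) c n).indicator (fun _ => 1) | ℱ n] x
      ≤ μ⁻[W | ℱ n] x := by
  set w : ℕ → Ω → ℝ≥0∞ := fun i => μ⁻[W | ℱ i]
  have hw : ∀ i, Measurable[ℱ i] (w i) := fun i => measurable_condLExp _ _ _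
  have hA := measurableSet_passage hw hc
  have h1 := condLExp_mul_left (μ := μ) (ℱ.le n)
    (measurable_const.indicator hA : Measurable ((passage w c n).indicator fun _ => (1 : ℝ≥0∞))) hc
  have h2 : μ⁻[fun x => c x * (passage w c n).indicator (fun _ => 1) x | ℱ n] ≤ᵐ[μ] w n := by
    refine condLExp_le_of_forall_setLIntegral_le (ℱ.le n) (hw n) fun s hs => ?_
    have hs0 := ℱ.le n _ hs
    have hB := measurableSet_firstPassage hw hc
    have hsum : ∀ f : Ω → ℝ≥0∞, ∫⁻ x in passage w c n ∩ s, f x ∂μ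
        = ∑' i, ∫⁻ x in firstPassage w c n i ∩ s, f x ∂μ := by
      intro f
      rw [← Measure.restrict_restrict hA, ← iUnion_firstPassage,
        lintegral_iUnion (fun i => ℱ.le i _ (hB i)) (pairwise_disjoint_firstPassage w c n)]
      simp only [Measure.restrict_restrict (ℱ.le _ _ (hB _))]
    calc ∫⁻ x in s, c x * (passage w c n).indicator (fun _ => 1) x ∂μ
        = ∫⁻ x in s, (passage w c n).indicator c x ∂μ := by
          refine lintegral_congr fun x => ?_
          by_cases hx : x ∈ passage w c n <;> simp [hx]
      _ = ∫⁻ x in passage w c n ∩ s, c x ∂μ := by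
          rw [lintegral_indicator hA, Measure.restrict_restrict hA]
      -- Decompose by the first passage time: on the i-th piece `c < w i`, and since that piece lies
      -- in `ℱ i`, `w i` and `W` have the same integral over it.
      _ ≤ ∫⁻ x in passage w c n ∩ s, W x ∂μ := by
          rw [hsum, hsum]
          refine ENNReal.tsum_le_tsum fun i => ?_
          by_cases hi : n ≤ i
          · have hBs : MeasurableSet[ℱ i] (firstPassage w c n i ∩ s) :=
              (hB i).inter (ℱ.mono hi _ hs)
            rw [← setLIntegral_condLExp (ℱ.le i) μ W hBs]
            exact setLIntegral_mono (measurable_condLExp' _ _ _) fun x hx => hx.1.2.1.le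
          · have : firstPassage w c n i = ∅ := by
              ext x
              simp [firstPassage, hi]
            simp [this]
      _ ≤ ∫⁻ x in s, W x ∂μ := lintegral_mono_set Set.inter_subset_right
      _ = ∫⁻ x in s, w n x ∂μ := (setLIntegral_condLExp (ℱ.le n) μ W hs).symm
  filter_upwards [h1, h2] with x hx1 hx2
  rwa [← hx1]

end FirstPassage

/-! ### The reverse Hölder inequality by iterated stopping -/

section ReverseHolder

variable {Ω : Type*} {m m0 : MeasurableSpace Ω} {μ : Measure Ω} {ℱ : Filtration ℕ m0}
  {W : Ω → ℝ≥0∞}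

/-- This and its converse below translate conditional probability bounds into mass bounds localised
to sets of `m`. Masses add up over the pieces of different first passage times, where conditioning
is on different σ-fields. -/
theorem measure_inter_le_of_condLExp_le (hm : m ≤ m0) [SigmaFinite (μ.trim hm)] {A H : Set Ω}
    {c : ℝ≥0∞} (hA : MeasurableSet A) (hH : MeasurableSet[m] H)
    (h : ∀ᵐ x ∂μ, x ∈ H → μ⁻[A.indicator (fun _ => 1) | m] x ≤ c) : μ (A ∩ H) ≤ c * μ H := by
  have h1 := setLIntegral_condLExp hm μ (A.indicator fun _ => (1 : ℝ≥0∞)) hH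
  rw [lintegral_indicator hA, setLIntegral_const, one_mul, Measure.restrict_apply hA] at h1
  rw [← h1, ← setLIntegral_const]
  exact setLIntegral_mono_ae' (hm _ hH) h

theorem condLExp_le_of_measure_inter_le (hm : m ≤ m0) [SigmaFinite (μ.trim hm)] {A : Set Ω}
    {c : ℝ≥0∞} (hA : MeasurableSet A) (h : ∀ H, MeasurableSet[m] H → μ (A ∩ H) ≤ c * μ H) :
    ∀ᵐ x ∂μ, μ⁻[A.indicator (fun _ => 1) | m] x ≤ c := by
  refine condLExp_le_of_forall_setLIntegral_le hm measurable_const fun s hs => ?_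
  rw [lintegral_indicator hA, setLIntegral_const, one_mul, Measure.restrict_apply hA,
    setLIntegral_const]
  exact h s hs

/-- Lévy's upward theorem, the point where the filtration must generate the whole σ-field: `w i → W`
almost everywhere, so any level below `W x` is exceeded at arbitrarily late times. The level is
quantified inside the almost-everywhere statement, so it may depend on the point. -/
theorem ae_le_iSup_condLExp [IsFiniteMeasure μ] (hℱ : ⨆ n, ℱ n = m0) (hW : Measurable W)
    (hint : ∫⁻ x, W x ∂μ ≠ ∞) (n : ℕ) :
    ∀ᵐ x ∂μ, ∀ c, c < W x → x ∈ passage (fun i => μ⁻[W | ℱ i]) (fun _ => c) n := by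
  have hfin := ae_lt_top hW hint
  have hi : Integrable (fun x => (W x).toReal) μ := integrable_toReal_of_lintegral_ne_top
    hW.aemeasurable hint
  have hsm : StronglyMeasurable[⨆ n, ℱ n] fun x => (W x).toReal := by
    rw [hℱ]
    exact hW.ennreal_toReal.stronglyMeasurable
  have h1 := ae_all_iff.2 fun i => toReal_condLExp (ℱ i) (μ := μ) hW.aemeasurable hint
  have h2 := ae_all_iff.2 fun i => condLExp_ne_top (mΩ := ℱ i) (P := μ) hint
  filter_upwards [hi.tendsto_ae_condExp hsm, h1, h2, hfin] with x hx hx1 hx2 hx3 c hc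
  simp only [← hx1] at hx
  have ht : Filter.Tendsto (fun i => μ⁻[W | ℱ i] x) Filter.atTop (nhds (W x)) :=
    (ENNReal.tendsto_toReal_iff hx2 hx3.ne).1 hx
  obtain ⟨i, hi, hin⟩ := ((ht.eventually_const_lt hc).and (Filter.eventually_ge_atTop n)).exists
  exact ⟨i, hin, hi⟩

variable [IsFiniteMeasure μ] {C α β b : ℝ≥0∞}

/-- One step of the Calderón–Zygmund iteration: from level `b ^ k` to level `b ^ (k + 1)` the mass
of the passage event shrinks by the factor `β`. -/
theorem withDensity_passage_succ_le (hW : Measurable W) (hpos : ∀ᵐ x ∂μ, W x ≠ 0)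
    (hint : ∫⁻ x, W x ∂μ ≠ ∞)
    (hS : ∀ n, ∀ᵐ x ∂μ, μ⁻[W | ℱ (n + 1)] x ≤ C * μ⁻[W | ℱ n] x)
    (hM : ∀ n, ∀ A, MeasurableSet A → ∀ᵐ x ∂μ, μ⁻[A.indicator (fun _ => 1) | ℱ n] x ≤ α →
      (μ.withDensity W)⁻[A.indicator (fun _ => 1) | ℱ n] x ≤ β)
    (hb1 : 1 ≤ b) (hb : b ≠ ∞) (hCb : C ≤ α * b) (n k : ℕ) {G : Set Ω}
    (hG : MeasurableSet[ℱ n] G) :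
    μ.withDensity W (passage (fun i => μ⁻[W | ℱ i]) (fun x => b ^ (k + 1) * μ⁻[W | ℱ n] x) n ∩ G)
      ≤ β * μ.withDensity W
        (passage (fun i => μ⁻[W | ℱ i]) (fun x => b ^ k * μ⁻[W | ℱ n] x) n ∩ G) := by
  have := isFiniteMeasure_withDensity hint
  set ν := μ.withDensity W with hν
  set w : ℕ → Ω → ℝ≥0∞ := fun i => μ⁻[W | ℱ i] with hwdef
  have hw : ∀ i, Measurable[ℱ i] (w i) := fun i => measurable_condLExp _ _ _
  have hc : ∀ k, Measurable[ℱ n] fun x => b ^ k * w n x := fun k => (hw n).const_mul _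
  set B := firstPassage w (fun x => b ^ k * w n x) n with hBdef
  have hB : ∀ i, MeasurableSet[ℱ i] (B i) := measurableSet_firstPassage hw (hc k)
  set A := fun i => passage w (fun x => b ^ (k + 1) * w n x) i with hAdef
  have hb0 : b ≠ 0 := (one_pos.trans_le hb1).ne'
  -- As `b ^ k ≥ 1`, no passage occurs at time n itself. A first passage time i therefore has a
  -- predecessor `i - 1 ≥ n`, at which the martingale was still below the level.
  have hBi : ∀ i, B i = ∅ ∨ n < i := by
    intro i
    rcases lt_or_ge n i with h | h
    · exact .inr h
    · left
      ext x
      simp only [Set.mem_empty_iff_false, iff_false]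
      rintro ⟨hi, hx, -⟩
      obtain rfl := le_antisymm hi h
      exact (le_mul_of_one_le_left zero_le (one_le_pow₀ hb1)).not_gt hx
  have hkey : ∀ i, ν (A i ∩ (B i ∩ G)) ≤ β * ν (B i ∩ G) := by
    intro i
    rcases hBi i with h | hi
    · simp [h]
    have hc' : Measurable[ℱ i] fun x => b ^ (k + 1) * w n x := (hc _).mono (ℱ.mono hi.le) le_rfl
    have hA : MeasurableSet (A i) := measurableSet_passage hw hc'
    refine measure_inter_le_of_condLExp_le (ℱ.le i) hA ((hB i).inter (ℱ.mono hi.le _ hG)) ?_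
    refine (withDensity_absolutelyContinuous μ W).ae_le ?_
    obtain ⟨j, rfl⟩ : ∃ j, i = j + 1 := ⟨i - 1, by omega⟩
    filter_upwards [hS j, hM (j + 1) _ hA, mul_condLExp_passage_le (μ := μ) (W := W) hc',
      condLExp_pos (ℱ.le n) hW hpos, condLExp_ne_top (mΩ := ℱ n) hint]
      with x hxS hxM hxd hx0 hxt hx
    refine hxM ?_
    have hle : w j x ≤ b ^ k * w n x := hx.1.2.2 j (by omega) (by omega)
    have hne : b ^ (k + 1) * w n x ≠ 0 := mul_ne_zero (pow_ne_zero _ hb0) hx0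
    have hnt : b ^ (k + 1) * w n x ≠ ∞ := ENNReal.mul_ne_top (ENNReal.pow_ne_top hb) hxt
    refine (ENNReal.mul_le_mul_iff_right hne hnt).1 (hxd.trans ?_)
    -- The overshoot at the stopping time is at most C, and `C ≤ α * b`; cancelling the level in
    -- Doob's inequality leaves the bound α that `hM` requires.
    calc μ⁻[W | ℱ (j + 1)] x ≤ C * w j x := hxS
      _ ≤ (α * b) * (b ^ k * w n x) := mul_le_mul' hCb hle
      _ = b ^ (k + 1) * w n x * α := by ring
  calc ν (passage w (fun x => b ^ (k + 1) * w n x) n ∩ G)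
      ≤ ν (⋃ i, A i ∩ (B i ∩ G)) := by
        -- Exceeding the higher level entails exceeding the lower one, and not before the first
        -- passage of the lower one.
        refine measure_mono ?_
        rintro x ⟨⟨l, hl, hlx⟩, hxG⟩
        have hkk : b ^ k * w n x ≤ b ^ (k + 1) * w n x :=
          mul_le_mul' (pow_le_pow_right₀ hb1 k.le_succ) le_rfl
        have hx : x ∈ ⋃ i, B i := by
          rw [hBdef, iUnion_firstPassage]
          exact ⟨l, hl, hkk.trans_lt hlx⟩
        obtain ⟨i, hi⟩ := Set.mem_iUnion.1 hx
        refine Set.mem_iUnion.2 ⟨i, ⟨l, ?_, hlx⟩, hi, hxG⟩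
        by_contra hli
        exact (hi.2.2 l hl (not_le.1 hli)).not_gt (hkk.trans_lt hlx)
    _ ≤ ∑' i, ν (A i ∩ (B i ∩ G)) := measure_iUnion_le _
    _ ≤ ∑' i, β * ν (B i ∩ G) := ENNReal.tsum_le_tsum hkey
    _ = β * ν (⋃ i, B i ∩ G) := by
        rw [ENNReal.tsum_mul_left, measure_iUnion]
        · intro i j hij
          exact (pairwise_disjoint_firstPassage _ _ _ hij).mono
            Set.inter_subset_left Set.inter_subset_left
        · exact fun i => (ℱ.le i _ (hB i)).inter (ℱ.le n _ hG)
    _ = β * ν (passage w (fun x => b ^ k * w n x) n ∩ G) := by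
        rw [← Set.iUnion_inter, hBdef, iUnion_firstPassage]

theorem condLExp_withDensity_passage_le (hW : Measurable W) (hpos : ∀ᵐ x ∂μ, W x ≠ 0)
    (hint : ∫⁻ x, W x ∂μ ≠ ∞)
    (hS : ∀ n, ∀ᵐ x ∂μ, μ⁻[W | ℱ (n + 1)] x ≤ C * μ⁻[W | ℱ n] x)
    (hM : ∀ n, ∀ A, MeasurableSet A → ∀ᵐ x ∂μ, μ⁻[A.indicator (fun _ => 1) | ℱ n] x ≤ α →
      (μ.withDensity W)⁻[A.indicator (fun _ => 1) | ℱ n] x ≤ β)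
    (hb1 : 1 ≤ b) (hb : b ≠ ∞) (hCb : C ≤ α * b) (n k : ℕ) :
    ∀ᵐ x ∂(μ.withDensity W), (μ.withDensity W)⁻[(passage (fun i => μ⁻[W | ℱ i])
      (fun x => b ^ k * μ⁻[W | ℱ n] x) n).indicator (fun _ => 1) | ℱ n] x ≤ β ^ k := by
  have := isFiniteMeasure_withDensity hint
  refine condLExp_le_of_measure_inter_le (ℱ.le n)
    (measurableSet_passage (fun i => measurable_condLExp _ _ _)
      ((measurable_condLExp _ _ _).const_mul _)) fun H hH => ?_
  induction k with
  | zero => simpa using measure_mono Set.inter_subset_right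
  | succ k ih =>
    calc _ ≤ _ := withDensity_passage_succ_le hW hpos hint hS hM hb1 hb hCb n k hH
      _ ≤ β * (β ^ k * μ.withDensity W H) := by gcongr
      _ = _ := by ring

/-- Take the least k with `W x ≤ b ^ k * w n x`. If `k = 0`, the summand 1 suffices; if `k = l + 1`,
then `W x` exceeds level l, so the passage event for l occurs and its single term dominates. -/
theorem rpow_le_tsum_indicator {w : ℕ → Ω → ℝ≥0∞} {n : ℕ} {x : Ω} {r : ℝ} (hr : 0 < r)
    (hb1 : 1 < b) (h0 : w n x ≠ 0) (ht : W x ≠ ∞)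
    (hsup : ∀ c, c < W x → x ∈ passage w (fun _ => c) n) :
    W x ^ r ≤ w n x ^ r * (1 + ∑' k : ℕ, (b ^ (k + 1)) ^ r *
      (passage w (fun x => b ^ k * w n x) n).indicator (fun _ => 1) x) := by
  classical
  have hex : ∃ k : ℕ, W x ≤ b ^ k * w n x := by
    have ht' : Filter.Tendsto (fun k : ℕ => b ^ k * w n x) Filter.atTop (nhds (∞ * w n x)) :=
      ENNReal.Tendsto.mul_const (ENNReal.tendsto_pow_atTop_nhds_top_iff.2 hb1)
        (.inl ENNReal.top_ne_zero)
    rw [ENNReal.top_mul h0] at ht'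
    exact (ht'.eventually_const_le ht.lt_top).exists
  set k := Nat.find hex with hk
  have hspec : W x ≤ b ^ k * w n x := Nat.find_spec hex
  rcases Nat.eq_zero_or_pos k with h | h
  · rw [h, pow_zero, one_mul] at hspec
    calc W x ^ r ≤ w n x ^ r * 1 := by rw [mul_one]; gcongr
      _ ≤ _ := by gcongr; exact le_self_add
  · obtain ⟨l, hl⟩ : ∃ l, k = l + 1 := ⟨k - 1, by omega⟩
    have hlt : b ^ l * w n x < W x := not_le.1 (Nat.find_min hex (by omega))
    have hmem : x ∈ passage w (fun x => b ^ l * w n x) n := hsup _ hlt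
    calc W x ^ r ≤ (b ^ (l + 1) * w n x) ^ r := by rw [← hl]; gcongr
      _ = w n x ^ r * ((b ^ (l + 1)) ^ r *
          (passage w (fun x => b ^ l * w n x) n).indicator (fun _ => 1) x) := by
        rw [ENNReal.mul_rpow_of_nonneg _ _ hr.le, Set.indicator_of_mem hmem, mul_one, mul_comm]
      _ ≤ _ := by
        gcongr
        refine le_trans ?_ le_add_self
        exact ENNReal.le_tsum (f := fun k : ℕ => (b ^ (k + 1)) ^ r *
          (passage w (fun x => b ^ k * w n x) n).indicator (fun _ => 1) x) l

/-- Continuity in r at 0, where the product equals `β < 1`. -/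
theorem exists_rpow_mul_lt_one (hb : b ≠ ∞) (hb1 : 1 < b) (hβ1 : β < 1) :
    ∃ r : ℝ, 0 < r ∧ b ^ r * β < 1 := by
  have hpos : 0 < b.toReal := ENNReal.toReal_pos (one_pos.trans hb1).ne' hb
  have hbr : ∀ r : ℝ, b ^ r = ENNReal.ofReal (b.toReal ^ r) := fun r => by
    rw [← ENNReal.ofReal_rpow_of_pos hpos, ENNReal.ofReal_toReal hb]
  have hc : Filter.Tendsto (fun r : ℝ => b ^ r * β) (nhds 0) (nhds (b ^ (0 : ℝ) * β)) := by
    simp only [hbr]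
    exact ENNReal.Tendsto.mul_const
      (ENNReal.tendsto_ofReal (Real.continuousAt_const_rpow hpos.ne').tendsto) (.inl (by simp))
  rw [ENNReal.rpow_zero, one_mul] at hc
  have h := ((hc.eventually_lt_const hβ1).filter_mono nhdsWithin_le_nhds).and
    (self_mem_nhdsWithin : Set.Ioi (0 : ℝ) ∈ nhdsWithin 0 (Set.Ioi 0))
  obtain ⟨r, hr1, hr2⟩ := h.exists
  exact ⟨r, hr2, hr1⟩

/-- The Gehring–Coifman–Fefferman reverse Hölder inequality for martingale weights: the
Muckenhoupt condition `A_∞` and bounded growth of the density martingale give higher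
integrability. -/
theorem exists_reverseHolder (hℱ : ⨆ n, ℱ n = m0) (hW : Measurable W)
    (hpos : ∀ᵐ x ∂μ, W x ≠ 0) (hint : ∫⁻ x, W x ∂μ ≠ ∞) (hC : 1 ≤ C) (hCt : C ≠ ∞)
    (hα0 : α ≠ 0) (hα1 : α < 1) (hβ1 : β < 1)
    (hS : ∀ n, ∀ᵐ x ∂μ, μ⁻[W | ℱ (n + 1)] x ≤ C * μ⁻[W | ℱ n] x)
    (hM : ∀ n, ∀ A, MeasurableSet A → ∀ᵐ x ∂μ, μ⁻[A.indicator (fun _ => 1) | ℱ n] x ≤ α →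
      (μ.withDensity W)⁻[A.indicator (fun _ => 1) | ℱ n] x ≤ β) :
    ∃ r : ℝ, 0 < r ∧ ∃ K : ℝ≥0∞, K ≠ ∞ ∧ ∀ n, ∀ᵐ x ∂μ,
      μ⁻[fun y => W y ^ (1 + r) | ℱ n] x ≤ K * μ⁻[W | ℱ n] x ^ (1 + r) := by
  have hαt : α ≠ ∞ := (hα1.trans ENNReal.one_lt_top).ne
  obtain ⟨b, hb1, hb, hCb⟩ : ∃ b : ℝ≥0∞, 1 < b ∧ b ≠ ∞ ∧ C ≤ α * b := by
    -- The ratio of levels is chosen so that overshoot C divided by b is exactly α.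
    refine ⟨C / α, ?_, ENNReal.div_ne_top hCt hα0, (ENNReal.mul_div_cancel hα0 hαt).ge⟩
    rw [ENNReal.lt_div_iff_mul_lt (.inl hα0) (.inl hαt), one_mul]
    exact hα1.trans_le hC
  obtain ⟨r, hr, hbr⟩ := exists_rpow_mul_lt_one hb hb1 hβ1
  -- The constant is 1 plus the sum over k of `(b ^ (k + 1)) ^ r * β ^ k`.
  refine ⟨r, hr, 1 + b ^ r * (1 - b ^ r * β)⁻¹, ?_, fun n => ?_⟩
  · refine ENNReal.add_ne_top.2 ⟨ENNReal.one_ne_top, ENNReal.mul_ne_top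
      (ENNReal.rpow_ne_top_of_nonneg hr.le hb) (ENNReal.inv_ne_top.2 (tsub_pos_of_lt hbr).ne')⟩
  have := isFiniteMeasure_withDensity hint
  set ν := μ.withDensity W with hν
  have hac : ν ≪ μ := withDensity_absolutelyContinuous μ W
  have hac' : μ ≪ ν := withDensity_absolutelyContinuous' hW.aemeasurable hpos
  set w : ℕ → Ω → ℝ≥0∞ := fun i => μ⁻[W | ℱ i] with hwdef
  have hw : ∀ i, Measurable[ℱ i] (w i) := fun i => measurable_condLExp _ _ _
  set E := fun k : ℕ => passage w (fun x => b ^ k * w n x) n with hEdef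
  have hE : ∀ k, MeasurableSet (E k) := fun k => measurableSet_passage hw ((hw n).const_mul _)
  set f : ℕ → Ω → ℝ≥0∞ := fun k => (E k).indicator fun _ => 1 with hf
  have hfm : ∀ k, Measurable (f k) := fun k => measurable_const.indicator (hE k)
  set g : Ω → ℝ≥0∞ := fun x => 1 + ∑' k : ℕ, (b ^ (k + 1)) ^ r * f k x with hg
  have hgm : Measurable g :=
    measurable_const.add (Measurable.tsum fun k => (hfm k).const_mul _)
  have h1 : ν⁻[fun y => W y ^ r | ℱ n] ≤ᵐ[ν] ν⁻[fun x => w n x ^ r * g x | ℱ n] := by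
    refine condLExp_mono (hac.ae_le ?_)
    filter_upwards [ae_le_iSup_condLExp hℱ hW hint n, condLExp_pos (ℱ.le n) hW hpos,
      ae_lt_top hW hint] with x hx1 hx2 hx3
    exact rpow_le_tsum_indicator hr hb1 hx2 hx3.ne hx1
  have h2 : ν⁻[fun x => w n x ^ r * g x | ℱ n] =ᵐ[ν] fun x => w n x ^ r * ν⁻[g | ℱ n] x :=
    condLExp_mul_left (ℱ.le n) hgm ((hw n).pow_const r)
  have h3 : ν⁻[g | ℱ n] =ᵐ[ν]
      fun x => 1 + ∑' k : ℕ, (b ^ (k + 1)) ^ r * ν⁻[f k | ℱ n] x := by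
    have e1 := condLExp_fun_add (μ := ν) (m := ℱ n) (f := fun _ => 1) measurable_const
      (fun x => ∑' k : ℕ, (b ^ (k + 1)) ^ r * f k x)
    have e2 := condLExp_tsum (P := ν) (ℱ n) (X := fun (k : ℕ) x => (b ^ (k + 1)) ^ r * f k x)
      fun k => ((hfm k).const_mul _).aemeasurable
    have e3 := ae_all_iff.2 fun k =>
      condLExp_fun_const_mul (μ := ν) (m := ℱ n) (hfm k) ((b ^ (k + 1)) ^ r)
    have e4 : (∑' k : ℕ, fun x => (b ^ (k + 1)) ^ r * f k x)
        = fun x => ∑' k : ℕ, (b ^ (k + 1)) ^ r * f k x := by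
      ext x
      rw [ENNReal.tsum_apply]
    rw [e4] at e2
    filter_upwards [e1, e2, e3] with x hx1 hx2 hx3
    rw [hx1, hx2, condLExp_const (ℱ.le n), ENNReal.tsum_apply]
    simp only [hx3]
  have h4 := ae_all_iff.2 fun k =>
    condLExp_withDensity_passage_le hW hpos hint hS hM hb1.le hb hCb n k
  -- Writing `W ^ (1 + r)` as `W * W ^ r`, Bayes' formula reduces the claim to the r-th moment under
  -- the weighted measure.
  have h5 : μ⁻[fun y => W y ^ (1 + r) | ℱ n] =ᵐ[μ]
      fun x => w n x * ν⁻[fun y => W y ^ r | ℱ n] x := by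
    refine Filter.EventuallyEq.trans (condLExp_congr_ae ?_)
      (condLExp_withDensity (ℱ.le n) hW hint (hW.pow_const r))
    filter_upwards [hpos, ae_lt_top hW hint] with x hx0 hxt
    rw [ENNReal.rpow_add _ _ hx0 hxt.ne, ENNReal.rpow_one]
  filter_upwards [hac'.ae_le h1, hac'.ae_le h2, hac'.ae_le h3, hac'.ae_le h4, h5,
    condLExp_pos (ℱ.le n) hW hpos, condLExp_ne_top (mΩ := ℱ n) hint]
    with x hx1 hx2 hx3 hx4 hx5 hx0 hxt
  have hsum : ∑' k : ℕ, (b ^ (k + 1)) ^ r * ν⁻[f k | ℱ n] x ≤ b ^ r * (1 - b ^ r * β)⁻¹ := by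
    rw [← ENNReal.tsum_geometric, ← ENNReal.tsum_mul_left]
    refine ENNReal.tsum_le_tsum fun k => ?_
    calc (b ^ (k + 1)) ^ r * ν⁻[f k | ℱ n] x ≤ (b ^ (k + 1)) ^ r * β ^ k := by
          gcongr
          exact hx4 k
      _ = b ^ r * (b ^ r * β) ^ k := by
        rw [← ENNReal.rpow_natCast, ← ENNReal.rpow_mul, mul_comm ((k + 1 : ℕ) : ℝ),
          ENNReal.rpow_mul, ENNReal.rpow_natCast, mul_pow, pow_succ]
        ring
  calc μ⁻[fun y => W y ^ (1 + r) | ℱ n] x = w n x * ν⁻[fun y => W y ^ r | ℱ n] x := hx5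
    _ ≤ w n x * (w n x ^ r * (1 + b ^ r * (1 - b ^ r * β)⁻¹)) := by
        gcongr
        refine hx1.trans (hx2.le.trans ?_)
        rw [hx3]
        gcongr
    _ = _ := by
        rw [ENNReal.rpow_add _ _ hx0 hxt, ENNReal.rpow_one]
        ring

end ReverseHolder

/-! ### Weights and the implications that hold without S -/

section Weights

variable {Ω : Type*} {m0 : MeasurableSpace Ω} {μ : Measure Ω} {ℱ : Filtration ℕ m0} {ω : Ω → ℝ}

theorem IsWeight.measurable_ofReal (hω : IsWeight μ ω) :
    Measurable fun x => ENNReal.ofReal (ω x) :=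
  hω.measurable.ennreal_ofReal

theorem IsWeight.ofReal_ne_zero (hω : IsWeight μ ω) : ∀ᵐ x ∂μ, ENNReal.ofReal (ω x) ≠ 0 :=
  hω.pos.mono fun _ hx => (ENNReal.ofReal_pos.2 hx).ne'

theorem IsWeight.lintegral_ne_top (hω : IsWeight μ ω) : ∫⁻ x, ENNReal.ofReal (ω x) ∂μ ≠ ∞ :=
  hω.integrable.lintegral_lt_top.ne

theorem IsWeight.wexp_ne_top (hω : IsWeight μ ω) (n : ℕ) : ∀ᵐ x ∂μ, wexp μ ℱ ω n x ≠ ∞ :=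
  condLExp_ne_top hω.lintegral_ne_top

theorem IsWeight.absolutelyContinuous (hω : IsWeight μ ω) : μ ≪ weighted μ ω :=
  withDensity_absolutelyContinuous' hω.measurable_ofReal.aemeasurable hω.ofReal_ne_zero

theorem IsWeight.powExp_eq (hω : IsWeight μ ω) (r : ℝ) (n : ℕ) :
    powExp μ ℱ ω r n =ᵐ[μ] μ⁻[fun x => ENNReal.ofReal (ω x) ^ r | ℱ n] :=
  condLExp_congr_ae (hω.pos.mono fun _ hx => (ENNReal.ofReal_rpow_of_pos hx).symm)

theorem IsWeight.isFiniteMeasure_weighted (hω : IsWeight μ ω) : IsFiniteMeasure (weighted μ ω) :=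
  isFiniteMeasure_withDensity hω.lintegral_ne_top

theorem IsWeight.condLExp_log_ne_top (hω : IsWeight μ ω) (n : ℕ) :
    ∀ᵐ x ∂μ, μ⁻[fun y => ENNReal.ofReal (Real.log (ω y)) | ℱ n] x ≠ ∞ := by
  refine condLExp_ne_top (ne_top_of_le_ne_top hω.lintegral_ne_top (lintegral_mono_ae ?_))
  filter_upwards [hω.pos] with x hx
  exact ENNReal.ofReal_le_ofReal ((Real.log_le_sub_one_of_pos hx).trans (by linarith))

theorem exp_logExp {n : ℕ} {x : Ω}
    (h₁ : μ⁻[fun y => ENNReal.ofReal (Real.log (ω y)) | ℱ n] x ≠ ∞)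
    (h₂ : μ⁻[fun y => ENNReal.ofReal (-Real.log (ω y)) | ℱ n] x ≠ ∞) :
    EReal.exp (logExp μ ℱ ω n x) = ENNReal.ofReal (Real.exp
      ((μ⁻[fun y => ENNReal.ofReal (Real.log (ω y)) | ℱ n] x).toReal
        - (μ⁻[fun y => ENNReal.ofReal (-Real.log (ω y)) | ℱ n] x).toReal)) := by
  have h : ∀ z : ℝ≥0∞, z ≠ ∞ → (z : EReal) = ((z.toReal : ℝ) : EReal) := fun z hz => by
    rw [← EReal.toReal_coe_ennreal, EReal.coe_toReal (by simpa using hz) (by simp)]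
  rw [logExp, h _ h₁, h _ h₂, ← EReal.coe_sub, EReal.exp_coe]

/-- Truncation at level t: above it, `(a / t) ^ (q - 1) ≥ 1`. The values `t = 0` and `t = ∞` are
allowed. -/
theorem le_or_le_rpow_mul_rpow {a t : ℝ≥0∞} {q : ℝ} (hq : 1 < q) (ha0 : a ≠ 0) (hat : a ≠ ∞) :
    a ≤ t ∨ a ≤ t ^ (1 - q) * a ^ q := by
  rcases le_or_gt a t with h | h
  · exact .inl h
  · right
    calc a = a ^ (1 - q) * a ^ q := by
          rw [← ENNReal.rpow_add _ _ ha0 hat, sub_add_cancel, ENNReal.rpow_one]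
      _ ≤ t ^ (1 - q) * a ^ q := by
          gcongr ?_ * _
          rw [← neg_sub, ENNReal.rpow_neg, ENNReal.rpow_neg]
          exact ENNReal.inv_le_inv.2 (ENNReal.rpow_le_rpow h.le (by linarith))

variable [IsProbabilityMeasure μ]

theorem IsWeight.wexp_ne_zero (hω : IsWeight μ ω) (n : ℕ) : ∀ᵐ x ∂μ, wexp μ ℱ ω n x ≠ 0 :=
  condLExp_pos (ℱ.le n) hω.measurable_ofReal hω.ofReal_ne_zero

/-- Bayes' formula for the conditional expectation with respect to a weight. -/
theorem IsWeight.condLExp_ofReal_mul (hω : IsWeight μ ω) (n : ℕ) {f : Ω → ℝ≥0∞}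
    (hf : Measurable f) :
    μ⁻[fun x => ENNReal.ofReal (ω x) * f x | ℱ n] =ᵐ[μ]
      fun x => wexp μ ℱ ω n x * (weighted μ ω)⁻[f | ℱ n] x :=
  condLExp_withDensity (ℱ.le n) hω.measurable_ofReal hω.lintegral_ne_top hf

/-- A linear inequality between random variables passes to the conditional expectation. -/
theorem condLExp_add_le_add {m : MeasurableSpace Ω} (hm : m ≤ m0)
    {f₁ f₂ f₃ f₄ c d : Ω → ℝ≥0∞} (h₁ : Measurable[m0] f₁) (h₂ : Measurable[m0] f₂) (h₃ : Measurable[m0] f₃)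
    (h₄ : Measurable[m0] f₄) (hc : Measurable[m] c) (hd : Measurable[m] d)
    (h : ∀ᵐ x ∂μ, f₁ x + f₂ x + c x ≤ f₃ x + f₄ x + d x) :
    ∀ᵐ x ∂μ, μ⁻[f₁ | m] x + μ⁻[f₂ | m] x + c x ≤ μ⁻[f₃ | m] x + μ⁻[f₄ | m] x + d x := by
  have key : ∀ {f g e : Ω → ℝ≥0∞}, Measurable[m0] f → Measurable[m0] g → Measurable[m] e →
      μ⁻[fun x => f x + g x + e x | m] =ᵐ[μ] fun x => μ⁻[f | m] x + μ⁻[g | m] x + e x := by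
    intro f g e hf hg he
    filter_upwards [condLExp_fun_add (μ := μ) (m := m) (f := fun x => f x + g x) (hf.add hg) e,
      condLExp_fun_add (μ := μ) (m := m) hf g] with x hx1 hx2
    rw [condLExp_eq_self hm μ he] at hx1
    rw [hx1, hx2]
  filter_upwards [key h₁ h₂ hc, key h₃ h₄ hd, condLExp_mono (mΩ := m) h] with x hx1 hx2 hx3
  rwa [hx1, hx2] at hx3

/-- Conditional Jensen for the logarithm of `ω ^ (-s)`, with `s = 1 / (p - 1)`: it gives `-s * E(log
ω | F_n) ≤ log Y`, hence `exp (-E(log ω | F_n)) ≤ Y ^ (p - 1)`. -/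
theorem aExp_of_unionAp (hω : IsWeight μ ω) (h : UnionAp μ ℱ ω) : AExp μ ℱ ω := by
  obtain ⟨C, p, hC, hp, h⟩ := h
  refine ⟨C, by linarith, fun n => ?_⟩
  have hp' : 0 < p - 1 := by linarith
  set s := 1 / (p - 1) with hs
  have hs0 : 0 < s := by positivity
  set Y := powExp μ ℱ ω (-s) n with hY
  have hYm : Measurable[ℱ n] Y := measurable_condLExp _ _ _
  have hpow : Measurable fun x => ENNReal.ofReal (ω x ^ (-s)) :=
    (hω.measurable.pow_const _).ennreal_ofReal
  have hlogp : Measurable fun x => ENNReal.ofReal (Real.log (ω x)) :=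
    (Real.measurable_log.comp hω.measurable).ennreal_ofReal
  have hlogm : Measurable fun x => ENNReal.ofReal (-Real.log (ω x)) :=
    (Real.measurable_log.comp hω.measurable).neg.ennreal_ofReal
  have hYlog := Real.measurable_log.comp hYm.ennreal_toReal
  have hYi : Measurable[ℱ n] fun x => (Y x)⁻¹ := hYm.inv
  have hY0 : ∀ᵐ x ∂μ, Y x ≠ 0 := condLExp_pos (ℱ.le n) hpow
    (hω.pos.mono fun x hx => (ENNReal.ofReal_pos.2 (Real.rpow_pos_of_pos hx _)).ne')
  have hYt : ∀ᵐ x ∂μ, Y x ≠ ∞ := by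
    filter_upwards [h n, hω.wexp_ne_zero (ℱ := ℱ) n] with x hx hx0 hxt
    rw [← hY, hxt, ENNReal.top_rpow_of_pos hp', ENNReal.mul_top hx0] at hx
    exact ENNReal.ofReal_ne_top (top_le_iff.1 hx)
  -- This is `log t ≤ t - 1` at `t = ω ^ (-s) / Y`, with each logarithm split into positive and
  -- negative parts and the subtracted terms moved across, so that both sides stay in [0, ∞].
  have hineq : ∀ᵐ x ∂μ, ENNReal.ofReal s * ENNReal.ofReal (-Real.log (ω x)) + 1
        + ENNReal.ofReal (-Real.log (Y x).toReal)
      ≤ (Y x)⁻¹ * ENNReal.ofReal (ω x ^ (-s)) + ENNReal.ofReal s * ENNReal.ofReal (Real.log (ω x))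
        + ENNReal.ofReal (Real.log (Y x).toReal) := by
    filter_upwards [hω.pos, hY0, hYt] with x hx hx0 hxt
    have hy : 0 < (Y x).toReal := ENNReal.toReal_pos hx0 hxt
    have hl := Real.log_le_sub_one_of_pos (x := (Y x).toReal⁻¹ * ω x ^ (-s)) (by positivity)
    rw [Real.log_mul (by positivity) (by positivity), Real.log_inv, Real.log_rpow hx] at hl
    have hi := ENNReal.inv_ne_top.2 hx0
    rw [← ENNReal.toReal_le_toReal (by finiteness) (by finiteness)]
    rw [ENNReal.toReal_add (by finiteness) (by finiteness),
      ENNReal.toReal_add (by finiteness) (by finiteness),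
      ENNReal.toReal_add (by finiteness) (by finiteness),
      ENNReal.toReal_add (by finiteness) (by finiteness)]
    simp only [ENNReal.toReal_mul, ENNReal.toReal_ofReal', ENNReal.toReal_one, ENNReal.toReal_inv,
      max_eq_left hs0.le, max_eq_left (Real.rpow_pos_of_pos hx (-s)).le]
    have e1 := max_zero_sub_max_neg_zero_eq_self (Real.log (ω x))
    have e2 := max_zero_sub_max_neg_zero_eq_self (Real.log (Y x).toReal)
    have e3 : s * Real.log (ω x)
      = s * max (Real.log (ω x)) 0 - s * max (-Real.log (ω x)) 0 := by rw [← mul_sub, e1]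
    linarith
  have hE := condLExp_add_le_add (ℱ.le n) (hlogm.const_mul (ENNReal.ofReal s)) measurable_const
    ((hYi.mono (ℱ.le n) le_rfl).mul hpow) (hlogp.const_mul (ENNReal.ofReal s))
    hYlog.neg.ennreal_ofReal hYlog.ennreal_ofReal hineq
  filter_upwards [h n, hE, hY0, hYt, hω.condLExp_log_ne_top (ℱ := ℱ) n,
    condLExp_mul_left (μ := μ) (ℱ.le n) hpow hYi,
    condLExp_fun_const_mul (μ := μ) (m := ℱ n) hlogp (ENNReal.ofReal s),
    condLExp_fun_const_mul (μ := μ) (m := ℱ n) hlogm (ENNReal.ofReal s),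
    hω.wexp_ne_top (ℱ := ℱ) n]
    with x hx hxE hx0 hxt hxl e1 e2 e3 hwt
  have hxE' : ENNReal.ofReal s * μ⁻[fun y => ENNReal.ofReal (-Real.log (ω y)) | ℱ n] x + 1
      + ENNReal.ofReal (-Real.log (Y x).toReal)
    ≤ 1 + ENNReal.ofReal s * μ⁻[fun y => ENNReal.ofReal (Real.log (ω y)) | ℱ n] x
      + ENNReal.ofReal (Real.log (Y x).toReal) := by
    have e4 : μ⁻[(fun x => (Y x)⁻¹) * fun x => ENNReal.ofReal (ω x ^ (-s)) | ℱ n] x = 1 :=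
      e1.trans (ENNReal.inv_mul_cancel hx0 hxt)
    have e5 : μ⁻[fun _ => (1 : ℝ≥0∞) | ℱ n] x = 1 := by rw [condLExp_const (ℱ.le n)]
    rwa [e2, e3, e4, e5] at hxE
  -- All terms on the right of `hxE'` are finite, so the expectation of the negative part is finite
  -- too.
  have hxm : μ⁻[fun y => ENNReal.ofReal (-Real.log (ω y)) | ℱ n] x ≠ ∞ := by
    intro hcon
    rw [hcon, ENNReal.mul_top (ENNReal.ofReal_pos.2 hs0).ne', top_add, top_add, top_le_iff] at hxE'
    exact absurd hxE' (by finiteness)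
  rw [exp_logExp hxl hxm, ← ENNReal.ofReal_mul (by linarith)]
  set lp := μ⁻[fun y => ENNReal.ofReal (Real.log (ω y)) | ℱ n] x
  set lm := μ⁻[fun y => ENNReal.ofReal (-Real.log (ω y)) | ℱ n] x
  have hy : 0 < (Y x).toReal := ENNReal.toReal_pos hx0 hxt
  have r1 := ENNReal.toReal_mono (by finiteness) hxE'
  rw [ENNReal.toReal_add (by finiteness) (by finiteness),
    ENNReal.toReal_add (by finiteness) (by finiteness),
    ENNReal.toReal_add (by finiteness) (by finiteness),
    ENNReal.toReal_add (by finiteness) (by finiteness)] at r1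
  simp only [ENNReal.toReal_mul, ENNReal.toReal_ofReal', ENNReal.toReal_one,
    max_eq_left hs0.le] at r1
  have r2 := max_zero_sub_max_neg_zero_eq_self (Real.log (Y x).toReal)
  have r3 : s * (lm.toReal - lp.toReal) ≤ Real.log (Y x).toReal := by linarith
  have r4 : lm.toReal - lp.toReal ≤ Real.log (Y x).toReal * (p - 1) := by
    rw [hs, one_div, inv_mul_le_iff₀ hp'] at r3
    linarith
  have r5 : Real.exp (lm.toReal - lp.toReal) ≤ (Y x).toReal ^ (p - 1) := by
    rw [Real.rpow_def_of_pos hy]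
    exact Real.exp_le_exp.2 r4
  have r6 := ENNReal.toReal_le_of_le_ofReal (by linarith) hx
  rw [ENNReal.toReal_mul, ← ENNReal.toReal_rpow] at r6
  refine (ENNReal.le_ofReal_iff_toReal_le hwt (by positivity)).2 ?_
  calc (wexp μ ℱ ω n x).toReal
      = (wexp μ ℱ ω n x).toReal * Real.exp (lm.toReal - lp.toReal)
        * Real.exp (lp.toReal - lm.toReal) := by
        rw [mul_assoc, ← Real.exp_add]
        simp
    _ ≤ (wexp μ ℱ ω n x).toReal * (Y x).toReal ^ (p - 1) * Real.exp (lp.toReal - lm.toReal) := by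
        gcongr
    _ ≤ C * Real.exp (lp.toReal - lm.toReal) := by gcongr

/-- Chebyshev for the logarithm. Where `ω ≤ exp (-κ) * ω_n`, `log (ω / ω_n) ≤ -κ`, so adding κ there
still leaves `log (ω / ω_n)` at most `ω / ω_n`. Conditional expectation gives κ times the
probability at most `1 + log C`. -/
theorem aCon_of_aExp (hω : IsWeight μ ω) (h : AExp μ ℱ ω) : ACon μ ℱ ω := by
  obtain ⟨C, hC, h⟩ := h
  -- Twice a bound for `1 + log C`, which makes `δ = 1 / 2` work.
  set κ := 2 * (1 + |Real.log C|) with hκ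
  have hκ0 : 0 < κ := by positivity
  refine ⟨Real.exp (-κ), 1 / 2, Real.exp_pos _, by simpa using hκ0, by norm_num, by norm_num, fun n => ?_⟩
  set w := wexp μ ℱ ω n with hw
  have hwm : Measurable[ℱ n] w := measurable_condLExp _ _ _
  have hwi : Measurable[ℱ n] fun x => (w x)⁻¹ := hwm.inv
  set B := {y | ENNReal.ofReal (ω y) ≤ ENNReal.ofReal (Real.exp (-κ)) * w y} with hB
  have hBm : MeasurableSet B := measurableSet_le hω.measurable_ofReal
    ((hwm.mono (ℱ.le n) le_rfl).const_mul _)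
  have hind : Measurable (B.indicator fun _ => (1 : ℝ≥0∞)) := measurable_const.indicator hBm
  have hlogp : Measurable fun x => ENNReal.ofReal (Real.log (ω x)) :=
    (Real.measurable_log.comp hω.measurable).ennreal_ofReal
  have hlogm : Measurable fun x => ENNReal.ofReal (-Real.log (ω x)) :=
    (Real.measurable_log.comp hω.measurable).neg.ennreal_ofReal
  have hwlog := Real.measurable_log.comp hwm.ennreal_toReal
  have hineq : ∀ᵐ x ∂μ, ENNReal.ofReal κ * B.indicator (fun _ => 1) x
        + ENNReal.ofReal (Real.log (ω x)) + ENNReal.ofReal (-Real.log (w x).toReal)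
      ≤ (w x)⁻¹ * ENNReal.ofReal (ω x) + ENNReal.ofReal (-Real.log (ω x))
        + ENNReal.ofReal (Real.log (w x).toReal) := by
    filter_upwards [hω.pos, hω.wexp_ne_zero (ℱ := ℱ) n, hω.wexp_ne_top (ℱ := ℱ) n]
      with x hx hx0 hxt
    have hy : 0 < (w x).toReal := ENNReal.toReal_pos hx0 hxt
    have hb : κ * (B.indicator (fun _ => (1 : ℝ≥0∞)) x).toReal + Real.log (ω x)
        - Real.log (w x).toReal ≤ (w x).toReal⁻¹ * ω x := by
      have hl := Real.log_le_sub_one_of_pos (x := (w x).toReal⁻¹ * ω x) (by positivity)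
      rw [Real.log_mul (by positivity) hx.ne', Real.log_inv] at hl
      by_cases hxB : x ∈ B
      · have h1 := ENNReal.toReal_mono (by finiteness) hxB
        rw [ENNReal.toReal_mul, ENNReal.toReal_ofReal hx.le,
          ENNReal.toReal_ofReal (Real.exp_pos _).le] at h1
        have h2 := Real.log_le_log hx h1
        rw [Real.log_mul (Real.exp_pos _).ne' hy.ne', Real.log_exp] at h2
        have h3 : 0 ≤ (w x).toReal⁻¹ * ω x := by positivity
        simp only [Set.indicator_of_mem hxB, ENNReal.toReal_one]
        linarith
      · simp only [Set.indicator_of_notMem hxB, ENNReal.toReal_zero]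
        linarith
    have hi := ENNReal.inv_ne_top.2 hx0
    have hit : B.indicator (fun _ => (1 : ℝ≥0∞)) x ≠ ∞ :=
      ne_top_of_le_ne_top ENNReal.one_ne_top (Set.indicator_le_self' (by simp) x)
    rw [← ENNReal.toReal_le_toReal (by finiteness) (by finiteness)]
    rw [ENNReal.toReal_add (by finiteness) (by finiteness),
      ENNReal.toReal_add (by finiteness) (by finiteness),
      ENNReal.toReal_add (by finiteness) (by finiteness),
      ENNReal.toReal_add (by finiteness) (by finiteness)]
    simp only [ENNReal.toReal_mul, ENNReal.toReal_ofReal', ENNReal.toReal_inv,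
      max_eq_left hκ0.le, max_eq_left hx.le]
    have e1 := max_zero_sub_max_neg_zero_eq_self (Real.log (ω x))
    have e2 := max_zero_sub_max_neg_zero_eq_self (Real.log (w x).toReal)
    linarith
  have hE := condLExp_add_le_add (ℱ.le n) (hind.const_mul (ENNReal.ofReal κ)) hlogp
    ((hwi.mono (ℱ.le n) le_rfl).mul hω.measurable_ofReal) hlogm
    hwlog.neg.ennreal_ofReal hwlog.ennreal_ofReal hineq
  filter_upwards [h n, hE, hω.wexp_ne_zero (ℱ := ℱ) n, hω.wexp_ne_top (ℱ := ℱ) n,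
    hω.condLExp_log_ne_top (ℱ := ℱ) n, condLExp_mul_left (μ := μ) (ℱ.le n) hω.measurable_ofReal hwi,
    condLExp_fun_const_mul (μ := μ) (m := ℱ n) hind (ENNReal.ofReal κ),
    condLExp_indicator_le_one (μ := μ) (ℱ.le n) B]
    with x hx hxE hx0 hxt hxl e1 e2 hP1
  have hxE' : ENNReal.ofReal κ * μ⁻[B.indicator (fun _ => 1) | ℱ n] x
      + μ⁻[fun y => ENNReal.ofReal (Real.log (ω y)) | ℱ n] x
      + ENNReal.ofReal (-Real.log (w x).toReal)
    ≤ 1 + μ⁻[fun y => ENNReal.ofReal (-Real.log (ω y)) | ℱ n] x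
      + ENNReal.ofReal (Real.log (w x).toReal) := by
    have e4 : μ⁻[(fun x => (w x)⁻¹) * fun x => ENNReal.ofReal (ω x) | ℱ n] x = 1 :=
      e1.trans (ENNReal.inv_mul_cancel hx0 hxt)
    rwa [e2, e4] at hxE
  -- Otherwise the exponential is 0, and the hypothesis would force `ω_n = 0`.
  have hxm : μ⁻[fun y => ENNReal.ofReal (-Real.log (ω y)) | ℱ n] x ≠ ∞ := by
    intro hcon
    have hbot : logExp μ ℱ ω n x = ⊥ := by
      rw [logExp, hcon, EReal.coe_ennreal_top, EReal.sub_top]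
    rw [hbot, EReal.exp_bot, mul_zero] at hx
    exact hx0 (le_antisymm hx zero_le)
  rw [exp_logExp hxl hxm, ← ENNReal.ofReal_mul hC.le] at hx
  unfold condProb
  set lp := μ⁻[fun y => ENNReal.ofReal (Real.log (ω y)) | ℱ n] x
  set lm := μ⁻[fun y => ENNReal.ofReal (-Real.log (ω y)) | ℱ n] x
  have hPt : μ⁻[B.indicator (fun _ => 1) | ℱ n] x ≠ ∞ := ne_top_of_le_ne_top ENNReal.one_ne_top hP1
  have hy : 0 < (w x).toReal := ENNReal.toReal_pos hx0 hxt
  have r1 := ENNReal.toReal_mono (by finiteness) hxE'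
  rw [ENNReal.toReal_add (by finiteness) (by finiteness),
    ENNReal.toReal_add (by finiteness) (by finiteness),
    ENNReal.toReal_add (by finiteness) (by finiteness),
    ENNReal.toReal_add (by finiteness) (by finiteness)] at r1
  simp only [ENNReal.toReal_mul, ENNReal.toReal_ofReal', ENNReal.toReal_one,
    max_eq_left hκ0.le] at r1
  have r2 := max_zero_sub_max_neg_zero_eq_self (Real.log (w x).toReal)
  have r3 := Real.log_le_log hy (ENNReal.toReal_le_of_le_ofReal (by positivity) hx)
  rw [Real.log_mul hC.ne' (Real.exp_pos _).ne', Real.log_exp] at r3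
  refine (ENNReal.le_ofReal_iff_toReal_le hPt (by norm_num)).2 ?_
  refine le_of_mul_le_mul_left ?_ hκ0
  have r4 := le_abs_self (Real.log C)
  linarith

theorem aM_of_aCon (hω : IsWeight μ ω) (h : ACon μ ℱ ω) : AM μ ℱ ω := by
  obtain ⟨γ, δ, hγ0, hγ1, hδ0, hδ1, h⟩ := h
  have hγδ : γ * (1 - δ) < 1 := by nlinarith
  have hγδ0 : 0 < γ * (1 - δ) := mul_pos hγ0 (by linarith)
  -- If A has conditional probability at most `(1 - δ) / 2`, the part of its complement where `ω > γ
  -- * ω_n` has at least `(1 - δ) / 2`, hence weighted probability at least `γ * (1 - δ) / 2`.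
  refine ⟨(1 - δ) / 2, 1 - γ * (1 - δ) / 2, by linarith, by linarith, by linarith, by linarith,
    fun n A hA => ?_⟩
  have := hω.isFiniteMeasure_weighted
  set w := wexp μ ℱ ω n with hw
  have hwm : Measurable[ℱ n] w := measurable_condLExp _ _ _
  set B := {y | ENNReal.ofReal (ω y) ≤ ENNReal.ofReal γ * w y} with hB
  have hBm : MeasurableSet B := measurableSet_le hω.measurable_ofReal
    ((hwm.mono (ℱ.le n) le_rfl).const_mul _)
  have hind : ∀ {A : Set Ω}, MeasurableSet A → Measurable (A.indicator fun _ => (1 : ℝ≥0∞)) :=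
    fun hA => measurable_const.indicator hA
  have hineq : ∀ x, ENNReal.ofReal γ * w x * Aᶜ.indicator (fun _ => 1) x
      ≤ ENNReal.ofReal γ * w x * B.indicator (fun _ => 1) x
        + ENNReal.ofReal (ω x) * Aᶜ.indicator (fun _ => 1) x := by
    intro x
    by_cases hxB : x ∈ B
    · rw [Set.indicator_of_mem hxB]
      refine le_trans ?_ le_self_add
      gcongr
      exact Set.indicator_le_self' (by simp) x
    · refine le_trans ?_ le_add_self
      gcongr
      exact (not_le.1 hxB).le
  have hgw := hwm.const_mul (ENNReal.ofReal γ)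
  have hac := hω.absolutelyContinuous
  filter_upwards [h n, condLExp_mono (mΩ := ℱ n) (P := μ) (.of_forall hineq),
    condLExp_fun_add (μ := μ) (m := ℱ n)
      (f := fun x => ENNReal.ofReal γ * w x * B.indicator (fun _ => 1) x)
      ((hgw.mono (ℱ.le n) le_rfl).mul (hind hBm))
      (fun x => ENNReal.ofReal (ω x) * Aᶜ.indicator (fun _ => 1) x),
    condLExp_mul_left (μ := μ) (ℱ.le n) (hind hA.compl) hgw,
    condLExp_mul_left (μ := μ) (ℱ.le n) (hind hBm) hgw,
    hω.condLExp_ofReal_mul (ℱ := ℱ) n (hind hA.compl),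
    condLExp_indicator_add_compl (μ := μ) (ℱ.le n) hA,
    hac.ae_le (condLExp_indicator_add_compl (ℱ.le n) hA), hω.wexp_ne_zero (ℱ := ℱ) n,
    hω.wexp_ne_top (ℱ := ℱ) n] with x hδ e1 e2 e3 e4 e5 e6 e7 hw0 hwt hα
  rw [e2, e3, e4, e5] at e1
  have e8 : ENNReal.ofReal γ * μ⁻[Aᶜ.indicator (fun _ => 1) | ℱ n] x
      ≤ ENNReal.ofReal γ * ENNReal.ofReal δ + (weighted μ ω)⁻[Aᶜ.indicator (fun _ => 1) | ℱ n] x := by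
    refine (ENNReal.mul_le_mul_iff_right hw0 hwt).1 ?_
    calc _ = ENNReal.ofReal γ * w x * μ⁻[Aᶜ.indicator (fun _ => 1) | ℱ n] x := by ring
      _ ≤ _ := e1
      _ ≤ ENNReal.ofReal γ * w x * ENNReal.ofReal δ
          + w x * (weighted μ ω)⁻[Aᶜ.indicator (fun _ => 1) | ℱ n] x := by
        gcongr
        exact hδ
      _ = _ := by ring
  unfold condProb at hα ⊢
  have t1 := ENNReal.add_ne_top.1 (e6.trans_ne ENNReal.one_ne_top)
  have t2 := ENNReal.add_ne_top.1 (e7.trans_ne ENNReal.one_ne_top)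
  have r1 := congrArg ENNReal.toReal e6
  have r2 := congrArg ENNReal.toReal e7
  rw [ENNReal.toReal_add t1.1 t1.2, ENNReal.toReal_one] at r1
  rw [ENNReal.toReal_add t2.1 t2.2, ENNReal.toReal_one] at r2
  have r3 := ENNReal.toReal_mono (ENNReal.add_ne_top.2 ⟨by finiteness, t2.2⟩) e8
  rw [ENNReal.toReal_add (by finiteness) t2.2, ENNReal.toReal_mul, ENNReal.toReal_mul,
    ENNReal.toReal_ofReal hγ0.le, ENNReal.toReal_ofReal hδ0.le] at r3
  have r4 := ENNReal.toReal_le_of_le_ofReal (by linarith) hα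
  refine (ENNReal.le_ofReal_iff_toReal_le t2.1 (by linarith)).2 ?_
  nlinarith

/-- Truncate ω on A at the random level `l * ω_n`: the lower part contributes at most `l * ω_n * P`,
and the upper part is controlled by the q-th moment. -/
theorem aCF_of_unionRH (hω : IsWeight μ ω) (h : UnionRH μ ℱ ω) : ACF μ ℱ ω := by
  obtain ⟨C, q, hC, hq, h⟩ := h
  have hq0 : 0 < q := by linarith
  have hq1 : 1 / q < 1 := by rw [div_lt_one hq0]; exact hq
  have hq2 : 0 < 1 / q := by positivity
  refine ⟨1 - 1 / q, 1 + C, by linarith, by linarith, by linarith, fun n A hA => ?_⟩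
  set w := wexp μ ℱ ω n with hw
  have hwm : Measurable[ℱ n] w := measurable_condLExp _ _ _
  set P := condProb μ ℱ A n with hP
  have hPm : Measurable[ℱ n] P := measurable_condLExp _ _ _
  -- This exponent balances the two parts: `l * P` and `l ^ (1 - q)` both equal `P ^ (1 - 1 / q)`.
  -- Where `P = 0`, `l = ∞` and both are 0.
  set l : Ω → ℝ≥0∞ := fun x => P x ^ (-(1 / q)) with hl
  have htm : Measurable[ℱ n] fun x => l x * w x := (hPm.pow_const _).mul hwm
  have hind : Measurable (A.indicator fun _ => (1 : ℝ≥0∞)) := measurable_const.indicator hA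
  have hWq := hω.measurable_ofReal.pow_const q
  have hineq : ∀ᵐ x ∂μ, ENNReal.ofReal (ω x) * A.indicator (fun _ => 1) x
      ≤ l x * w x * A.indicator (fun _ => 1) x
        + (l x * w x) ^ (1 - q) * ENNReal.ofReal (ω x) ^ q := by
    filter_upwards [hω.ofReal_ne_zero] with x hx
    by_cases hxA : x ∈ A
    · rw [Set.indicator_of_mem hxA, mul_one, mul_one]
      rcases le_or_le_rpow_mul_rpow (t := l x * w x) hq hx ENNReal.ofReal_ne_top with h | h
      · exact h.trans le_self_add
      · exact h.trans le_add_self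
    · simp [hxA]
  filter_upwards [h n, hω.powExp_eq (ℱ := ℱ) q n, condLExp_mono (mΩ := ℱ n) hineq,
    condLExp_fun_add (μ := μ) (m := ℱ n)
      (f := fun x => l x * w x * A.indicator (fun _ => 1) x)
      ((htm.mono (ℱ.le n) le_rfl).mul hind)
      (fun x => (l x * w x) ^ (1 - q) * ENNReal.ofReal (ω x) ^ q),
    condLExp_mul_left (μ := μ) (ℱ.le n) hind htm,
    condLExp_mul_left (μ := μ) (ℱ.le n) hWq (htm.pow_const (1 - q)),
    hω.condLExp_ofReal_mul (ℱ := ℱ) n hind,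
    condLExp_indicator_le_one (μ := μ) (ℱ.le n) A, hω.wexp_ne_zero (ℱ := ℱ) n,
    hω.wexp_ne_top (ℱ := ℱ) n] with x hx e0 e1 e2 e3 e4 e5 hP1 hw0 hwt
  rw [e2, e3, e4, e5, ← e0] at e1
  have hPt : P x ≠ ∞ := (hP1.trans_lt ENNReal.one_lt_top).ne
  have hl0 : l x ≠ 0 := by
    simp only [hl, ne_eq, ENNReal.rpow_eq_zero_iff, hPt, false_and, or_false, not_and, not_lt]
    intro _
    linarith
  have a1 : l x * P x = P x ^ (1 - 1 / q) := by
    rcases eq_or_ne (P x) 0 with h0 | h0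
    · rw [h0, mul_zero, ENNReal.zero_rpow_of_pos (by linarith)]
    · rw [sub_eq_neg_add, ENNReal.rpow_add _ _ h0 hPt, ENNReal.rpow_one]
  have a2 : l x ^ (1 - q) = P x ^ (1 - 1 / q) := by
    rw [← ENNReal.rpow_mul]
    congr 1
    field_simp
    ring
  have a3 : w x ^ (1 - q) * w x ^ q = w x := by
    rw [← ENNReal.rpow_add _ _ hw0 hwt, sub_add_cancel, ENNReal.rpow_one]
  refine (ENNReal.mul_le_mul_iff_right hw0 hwt).1 (e1.trans ?_)
  calc l x * w x * P x + (l x * w x) ^ (1 - q) * powExp μ ℱ ω q n x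
      ≤ l x * w x * P x + (l x ^ (1 - q) * w x ^ (1 - q)) * (ENNReal.ofReal C * w x ^ q) := by
        rw [ENNReal.mul_rpow_of_ne_zero hl0 hw0]
        gcongr
    _ = w x * (l x * P x) + l x ^ (1 - q) * ENNReal.ofReal C * (w x ^ (1 - q) * w x ^ q) := by
        ring
    _ = w x * (ENNReal.ofReal (1 + C) * P x ^ (1 - 1 / q)) := by
        rw [a1, a2, a3, ENNReal.ofReal_add one_pos.le (by linarith), ENNReal.ofReal_one]
        ring

theorem aMHat_of_aCF (hω : IsWeight μ ω) (h : ACF μ ℱ ω) : AMHat μ ℱ ω := by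
  obtain ⟨ε, C, hε0, hε1, hC, h⟩ := h
  have := hω.isFiniteMeasure_weighted
  -- If the weighted probability of A is at most 1/2, its complement has at least 1/2; solving `1 /
  -- 2 ≤ C * P ^ ε` for the probability P of the complement gives `P ≥ d`.
  set d : ℝ := (1 / (2 * C)) ^ (1 / ε) with hd
  have hC2 : 1 / (2 * C) < 1 := by rw [div_lt_one (by linarith)]; linarith
  have hd0 : 0 < d := by positivity
  have hd1 : d < 1 := Real.rpow_lt_one (by positivity) hC2 (by positivity)
  refine ⟨1 / 2, 1 - d, by norm_num, by norm_num, by linarith, by linarith, fun n A hA => ?_⟩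
  filter_upwards [h n _ hA.compl, condLExp_indicator_add_compl (μ := μ) (ℱ.le n) hA,
    hω.absolutelyContinuous.ae_le (condLExp_indicator_add_compl (ℱ.le n) hA)]
    with x hx e6 e7 hα
  unfold condProb at *
  have t1 := ENNReal.add_ne_top.1 (e6.trans_ne ENNReal.one_ne_top)
  have t2 := ENNReal.add_ne_top.1 (e7.trans_ne ENNReal.one_ne_top)
  have r1 := congrArg ENNReal.toReal e6
  have r2 := congrArg ENNReal.toReal e7
  rw [ENNReal.toReal_add t1.1 t1.2, ENNReal.toReal_one] at r1
  rw [ENNReal.toReal_add t2.1 t2.2, ENNReal.toReal_one] at r2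
  have r3 := ENNReal.toReal_mono (ENNReal.mul_ne_top ENNReal.ofReal_ne_top
    (ENNReal.rpow_ne_top_of_nonneg hε0.le t1.2)) hx
  rw [ENNReal.toReal_mul, ENNReal.toReal_ofReal (by linarith), ← ENNReal.toReal_rpow] at r3
  have r4 := ENNReal.toReal_le_of_le_ofReal (by norm_num) hα
  refine (ENNReal.le_ofReal_iff_toReal_le t1.1 (by linarith)).2 ?_
  have r5 : 1 / (2 * C) ≤ (μ⁻[Aᶜ.indicator (fun _ => 1) | ℱ n] x).toReal ^ ε := by
    rw [div_le_iff₀ (by linarith)]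
    linarith
  have r6 : d ≤ (μ⁻[Aᶜ.indicator (fun _ => 1) | ℱ n] x).toReal := by
    calc d ≤ ((μ⁻[Aᶜ.indicator (fun _ => 1) | ℱ n] x).toReal ^ ε) ^ (1 / ε) :=
          Real.rpow_le_rpow (by positivity) r5 (by positivity)
      _ = _ := by
          rw [← Real.rpow_mul ENNReal.toReal_nonneg, mul_one_div_cancel hε0.ne', Real.rpow_one]
  linarith

/-! ### The two implications that use S -/

theorem unionRH_of_aM (hℱ : ⨆ n, ℱ n = m0) (hω : IsWeight μ ω) (hS : CondS μ ℱ ω)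
    (h : AM μ ℱ ω) : UnionRH μ ℱ ω := by
  obtain ⟨C, hC, hS⟩ := hS
  obtain ⟨α, β, hα0, hα1, hβ0, hβ1, h⟩ := h
  obtain ⟨r, hr, K, hK, hRH⟩ := exists_reverseHolder hℱ hω.measurable_ofReal hω.ofReal_ne_zero
    hω.lintegral_ne_top (ENNReal.one_le_ofReal.2 hC.le) ENNReal.ofReal_ne_top
    (ENNReal.ofReal_pos.2 hα0).ne' (ENNReal.ofReal_lt_one.2 hα1) (ENNReal.ofReal_lt_one.2 hβ1)
    (fun n => (hS n).mono fun x hx => hx.2) h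
  -- Adding 2 only ensures that the constant exceeds 1.
  refine ⟨K.toReal + 2, 1 + r, by linarith [K.toReal_nonneg], by linarith, fun n => ?_⟩
  filter_upwards [hRH n, hω.powExp_eq (ℱ := ℱ) (1 + r) n] with x hx hx'
  rw [hx']
  refine hx.trans (mul_le_mul' ?_ le_rfl)
  exact (ENNReal.le_ofReal_iff_toReal_le hK (by linarith [K.toReal_nonneg])).2 (by linarith)

/-- Duality: `1 / ω` is a weight for `ω dμ`, its weighted measure is μ again, and the hypothesis is
the Muckenhoupt condition for this pair. -/
theorem unionAp_of_aMHat (hℱ : ⨆ n, ℱ n = m0) (hω : IsWeight μ ω) (hS : CondS μ ℱ ω)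
    (h : AMHat μ ℱ ω) : UnionAp μ ℱ ω := by
  obtain ⟨C, hC, hS⟩ := hS
  obtain ⟨α, β, hα0, hα1, hβ0, hβ1, h⟩ := h
  have := hω.isFiniteMeasure_weighted
  have hac : weighted μ ω ≪ μ := withDensity_absolutelyContinuous _ _
  have hac' := hω.absolutelyContinuous
  have hWm := hω.measurable_ofReal
  have hWi : Measurable fun x => (ENNReal.ofReal (ω x))⁻¹ := hWm.inv
  have hWt : ∀ᵐ x ∂μ, ENNReal.ofReal (ω x) ≠ ∞ := .of_forall fun _ => ENNReal.ofReal_ne_top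
  have hinv : (weighted μ ω).withDensity (fun x => (ENNReal.ofReal (ω x))⁻¹) = μ :=
    withDensity_inv_same hWm hω.ofReal_ne_zero hWt
  have hC0 : ENNReal.ofReal C ≠ 0 := (ENNReal.ofReal_pos.2 (by linarith)).ne'
  -- Bayes' formula for `f = 1 / ω` identifies the dual density martingale as `1 / ω_n`.
  have hdual : ∀ n, ∀ᵐ x ∂μ,
      (weighted μ ω)⁻[fun y => (ENNReal.ofReal (ω y))⁻¹ | ℱ n] x = (wexp μ ℱ ω n x)⁻¹ := by
    intro n
    have h1 : μ⁻[fun x => ENNReal.ofReal (ω x) * (ENNReal.ofReal (ω x))⁻¹ | ℱ n] =ᵐ[μ]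
        μ⁻[fun _ => 1 | ℱ n] := condLExp_congr_ae <| hω.ofReal_ne_zero.mono fun x hx =>
      ENNReal.mul_inv_cancel hx ENNReal.ofReal_ne_top
    filter_upwards [hω.condLExp_ofReal_mul (ℱ := ℱ) n hWi, h1] with x hx1 hx2
    rw [hx2, condLExp_const (ℱ.le n)] at hx1
    exact ENNReal.eq_inv_of_mul_eq_one_left (by rw [mul_comm]; exact hx1.symm)
  obtain ⟨r, hr, K, hK, hRH⟩ := exists_reverseHolder (μ := weighted μ ω)
    (W := fun x => (ENNReal.ofReal (ω x))⁻¹) (C := ENNReal.ofReal C) hℱ hWi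
    (.of_forall fun x => ENNReal.inv_ne_zero.2 ENNReal.ofReal_ne_top)
    (by rw [← setLIntegral_univ, ← withDensity_apply _ MeasurableSet.univ, hinv]; finiteness)
    (ENNReal.one_le_ofReal.2 hC.le) ENNReal.ofReal_ne_top
    (ENNReal.ofReal_pos.2 hα0).ne' (ENNReal.ofReal_lt_one.2 hα1) (ENNReal.ofReal_lt_one.2 hβ1)
    -- Taking inverses turns the lower bound in S into the upper growth bound for `1 / ω_n`.
    (fun n => by
      refine hac.ae_le ?_
      filter_upwards [hS n, hdual n, hdual (n + 1)] with x hx hx1 hx2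
      rw [hx1, hx2, ← ENNReal.inv_le_inv, inv_inv, ENNReal.mul_inv (.inl hC0) (.inl (by simp)),
        inv_inv, ← ENNReal.ofReal_inv_of_pos (by linarith), ← one_div]
      exact hx.1)
    (fun n A hA => by
      rw [hinv]
      exact hac.ae_le (h n A hA))
  -- With `p = 1 + 1 / r` the `A_p` exponent is `-r`, and `ω * ω ^ (-(1 + r)) = ω ^ (-r)` carries
  -- the dual estimate back to μ as `E(ω ^ (-r) | F_n) ≤ K * ω_n ^ (-r)`.
  refine ⟨(K ^ (1 / r)).toReal + 2, 1 + 1 / r, by linarith [(K ^ (1 / r)).toReal_nonneg],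
    by linarith [one_div_pos.2 hr], fun n => ?_⟩
  rw [add_sub_cancel_left, one_div_one_div]
  have hpow : μ⁻[fun x => ENNReal.ofReal (ω x) * (ENNReal.ofReal (ω x))⁻¹ ^ (1 + r) | ℱ n]
      =ᵐ[μ] powExp μ ℱ ω (-r) n := by
    refine Filter.EventuallyEq.trans (condLExp_congr_ae ?_) (hω.powExp_eq (-r) n).symm
    filter_upwards [hω.ofReal_ne_zero] with x hx
    rw [ENNReal.inv_rpow, ← ENNReal.rpow_neg]
    nth_rewrite 1 [← ENNReal.rpow_one (ENNReal.ofReal (ω x))]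
    rw [← ENNReal.rpow_add _ _ hx ENNReal.ofReal_ne_top]
    congr 1
    ring
  filter_upwards [hpow, hω.condLExp_ofReal_mul (ℱ := ℱ) n (hWi.pow_const (1 + r)),
    hac'.ae_le (hRH n), hdual n, hω.wexp_ne_zero (ℱ := ℱ) n, hω.wexp_ne_top (ℱ := ℱ) n]
    with x e1 e2 e3 e4 hw0 hwt
  rw [e4] at e3
  rw [← e1, e2]
  have e5 : wexp μ ℱ ω n x * (weighted μ ω)⁻[fun y => (ENNReal.ofReal (ω y))⁻¹ ^ (1 + r) | ℱ n] x
      ≤ K * wexp μ ℱ ω n x ^ (-r) := by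
    calc _ ≤ wexp μ ℱ ω n x * (K * (wexp μ ℱ ω n x)⁻¹ ^ (1 + r)) := mul_le_mul' le_rfl e3
      _ = K * (wexp μ ℱ ω n x ^ (1 : ℝ) * wexp μ ℱ ω n x ^ (-(1 + r))) := by
        rw [ENNReal.inv_rpow, ← ENNReal.rpow_neg, ENNReal.rpow_one]
        ring
      _ = _ := by
        rw [← ENNReal.rpow_add _ _ hw0 hwt]
        congr 2
        ring
  have hr' : 0 ≤ 1 / r := by positivity
  calc _ ≤ wexp μ ℱ ω n x * (K * wexp μ ℱ ω n x ^ (-r)) ^ (1 / r) :=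
        mul_le_mul' le_rfl (ENNReal.rpow_le_rpow e5 hr')
    _ = K ^ (1 / r) * (wexp μ ℱ ω n x ^ (1 : ℝ) * wexp μ ℱ ω n x ^ (-1 : ℝ)) := by
        rw [ENNReal.mul_rpow_of_nonneg _ _ hr', ← ENNReal.rpow_mul, neg_mul,
          mul_one_div_cancel hr.ne', ENNReal.rpow_one]
        ring
    _ = K ^ (1 / r) := by
        rw [← ENNReal.rpow_add _ _ hw0 hwt, add_neg_cancel, ENNReal.rpow_zero, mul_one]
    _ ≤ _ := (ENNReal.le_ofReal_iff_toReal_le (ENNReal.rpow_ne_top_of_nonneg hr' hK)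
        (by linarith [(K ^ (1 / r)).toReal_nonneg])).2 (by linarith)

end Weights

end MartingaleWeight

theorem theorem1p1 {Ω : Type*} {m0 : MeasurableSpace Ω} (μ : Measure Ω) [IsProbabilityMeasure μ]
    (ℱ : Filtration ℕ m0) (hℱ : (⨆ n : ℕ, ℱ n) = m0)
    (ω : Ω → ℝ) (hω : MartingaleWeight.IsWeight μ ω) :
    (MartingaleWeight.CondS μ ℱ ω →
      List.TFAE
        [MartingaleWeight.UnionAp μ ℱ ω,
          MartingaleWeight.AExp μ ℱ ω,
          MartingaleWeight.ACon μ ℱ ω,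
          MartingaleWeight.AM μ ℱ ω,
          MartingaleWeight.UnionRH μ ℱ ω,
          MartingaleWeight.ACF μ ℱ ω,
          MartingaleWeight.AMHat μ ℱ ω]) ∧
    (MartingaleWeight.UnionAp μ ℱ ω → MartingaleWeight.AExp μ ℱ ω) ∧
    (MartingaleWeight.AExp μ ℱ ω → MartingaleWeight.ACon μ ℱ ω) ∧
    (MartingaleWeight.ACon μ ℱ ω → MartingaleWeight.AM μ ℱ ω) ∧
    (MartingaleWeight.UnionRH μ ℱ ω → MartingaleWeight.ACF μ ℱ ω) ∧
    (MartingaleWeight.ACF μ ℱ ω → MartingaleWeight.AMHat μ ℱ ω) := by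
  refine ⟨fun hS => ?_, MartingaleWeight.aExp_of_unionAp hω, MartingaleWeight.aCon_of_aExp hω,
    MartingaleWeight.aM_of_aCon hω, MartingaleWeight.aCF_of_unionRH hω,
    MartingaleWeight.aMHat_of_aCF hω⟩
  tfae_have 1 → 2 := MartingaleWeight.aExp_of_unionAp hω
  tfae_have 2 → 3 := MartingaleWeight.aCon_of_aExp hω
  tfae_have 3 → 4 := MartingaleWeight.aM_of_aCon hω
  tfae_have 4 → 5 := MartingaleWeight.unionRH_of_aM hℱ hω hS
  tfae_have 5 → 6 := MartingaleWeight.aCF_of_unionRH hω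
  tfae_have 6 → 7 := MartingaleWeight.aMHat_of_aCF hω
  tfae_have 7 → 1 := MartingaleWeight.unionAp_of_aMHat hℱ hω hS
  tfae_finish
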